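/- Let $n\ge 0$, let $\mathbf A=\mathrm{diag}(\alpha_1,\dots,\alpha_{n+1})$ be a real diagonal matrix and let $q,p\in\mathbb R^{n+1}$ satisfy $\|q\|=1$ and $\langle q,p\rangle=0$. Let $a_1,\dots,a_k$ be the distinct eigenvalues of $\mathbf A$, let $m_1,\dots,m_k$ be their multiplicities, and let $r$ be the number of eigenvalues with $m_i>1$; assume that $r\ge 1$ (the degenerate case). Let $$\mathbf L(\lambda)=\lambda^2\mathbf A+\lambda\,(q\otimes p-p\otimes q)-q\otimes q .$$ Let the affine spectral curve be $\{(\lambda,\mu)\in\mathbb C^2:\det(\mathbf L(\lambda)-\mu)=0\}$. Let $\mathcal O(2)$ be the surface obtained by gluing two copies of $\mathbb C^2$ along $(\lambda,\mu)\mapsto(s,z)=(1/\lambda,\mu/\lambda^2)$, $\lambda\ne0$, and let the spectral curve $\mathcal C$ be the closure of the affine spectral curve in $\mathcal O(2)$. Put $$D(z)=\prod_{m_i=1}(z-a_i)\prod_{m_j>1}(z-a_j)^2,\qquad Q_z(x,y)=\langle (z-\mathbf A)^{-1}x,y\rangle .$$ Proposition (spectral curve components). There is a polynomial $Q\in\mathbb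 C[z]$ of degree $k+r-1$ such that $$Q_z(q,q)+Q_z(q,q)\,Q_z(p,p)-Q_z(q,p)^2=\frac{Q(z)}{D(z)}\qquad\text{for all } z\in\mathbb C\setminus\{a_1,\dots,a_k\},$$ and such that the following holds. For all $\lambda,z\in\mathbb C$, $$\det(\lambda^2z-\mathbf L(\lambda))=\lambda^{2n}\prod_{m_i>1}(z-a_i)^{m_i-2}\,\bigl(\lambda^2D(z)+Q(z)\bigr).$$ The spectral curve $\mathcal C$ is the union of 1. the point $\lambda=\mu=0$; 2. the (completed) parabolas $\mu=a_i\lambda^2$, for each eigenvalue $a_i$ of multiplicity $m_i\ge 3$; 3. the hyperelliptic curve $\mathcal C_h$ given in the coordinates $(\lambda,z)$, $\mu=\lambda^2 z$, by $$\lambda^2=-\frac{Q(z)}{\prod_{m_i=1}(z-a_i)\prod_{m_j>1}(z-a_j)^2},\qquad\text{that is,}\qquad \lambda^2D(z)+Q(z)=0$$ (more precisely, the closure in $\mathcal O(2)$ of the set of points $(\lambda,\mu)=(\lambda,\lambda^2z)$ with $\lambda^2D(z)+Q(z)=0$). The curve $\mathcal C_h$ is singular at the point $\lambda=\infty$, $z=a_j$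 for every $j$ with $m_j>1$ (that is, its equation $D(z)+s^2Q(z)=0$, with $s=1/\lambda$, and both partial derivatives of that equation vanish at $(s,z)=(0,a_j)$). The polynomial $\lambda^2D(z)+Q(z)$ is irreducible whenever $Q(a_i)\neq0$ for all $i$. The completion of $\mathcal C_h$ in $\mathbb P^1\times\mathbb P^1$, with coordinates $(\lambda,z)$ (the closure, as a scheme, of the affine curve $\lambda^2D(z)+Q(z)=0$), has arithmetic genus $k+r-1$; here the arithmetic genus of a projective curve with Hilbert polynomial $P$ is $1-P(0)$. -/

import Mathlib

/-- The Neumann Lax matrix `L(l) = l² A + l (q ∧ p) - q ⊗ q`, where `A = diag α` and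
`q ∧ p = q ⊗ p - p ⊗ q`, at a complex value `l` of the spectral parameter. -/
noncomputable def Neumann.laxMatrix {n : ℕ} (α q p : Fin (n + 1) → ℝ) (l : ℂ) :
    Matrix (Fin (n + 1)) (Fin (n + 1)) ℂ :=
  l ^ 2 • (Matrix.diagonal α).map (algebraMap ℝ ℂ)
    + l • (Matrix.vecMulVec q p - Matrix.vecMulVec p q).map (algebraMap ℝ ℂ)
    - (Matrix.vecMulVec q q).map (algebraMap ℝ ℂ)

namespace Neumann

open Polynomial

/-- The set of the distinct eigenvalues of `A = diag α`. -/
noncomputable def eigs {n : ℕ} (α : Fin (n + 1) → ℝ) : Finset ℝ := Finset.univ.image α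

/-- The multiplicity of `a` as an eigenvalue of `A = diag α`. -/
noncomputable def mult {n : ℕ} (α : Fin (n + 1) → ℝ) (a : ℝ) : ℕ :=
  (Finset.univ.filter fun j => α j = a).card

/-- The set of the eigenvalues of multiplicity greater than one. -/
noncomputable def multipleEigs {n : ℕ} (α : Fin (n + 1) → ℝ) : Finset ℝ :=
  (eigs α).filter fun a => 1 < mult α a

/-- The set of the eigenvalues of multiplicity one. -/
noncomputable def simpleEigs {n : ℕ} (α : Fin (n + 1) → ℝ) : Finset ℝ :=
  (eigs α).filter fun a => mult α a = 1

/-- `D(z) = ∏ (z - a)`, over simple eigenvalues, times `∏ (z - a)²`, over multiple ones. -/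
noncomputable def denom {n : ℕ} (α : Fin (n + 1) → ℝ) : ℂ[X] :=
  (∏ a ∈ simpleEigs α, (X - C (a : ℂ))) * ∏ a ∈ multipleEigs α, (X - C (a : ℂ)) ^ 2

/-- `⟨(z - A)⁻¹ x, y⟩` for `A = diag α`. -/
noncomputable def resolventForm {n : ℕ} (α x y : Fin (n + 1) → ℝ) (z : ℂ) : ℂ :=
  ∑ j, ((x j : ℂ) * (y j : ℂ)) / (z - (α j : ℂ))

/-- The affine spectral curve: the points `(l, μ)` of `ℂ²` with `det (L(l) - μ) = 0`. -/
def affineSpectralCurve {n : ℕ} (α q p : Fin (n + 1) → ℝ) : Set (ℂ × ℂ) :=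
  {x | (laxMatrix α q p x.1 - x.2 • (1 : Matrix (Fin (n + 1)) (Fin (n + 1)) ℂ)).det = 0}

/-- The coordinate change `(l, μ) ↦ (1 / l, μ / l²)`, for `l ≠ 0`, between two copies of `ℂ²`. -/
inductive GlueRel : (ℂ × ℂ) ⊕ (ℂ × ℂ) → (ℂ × ℂ) ⊕ (ℂ × ℂ) → Prop
  | glue (l μ : ℂ) (hl : l ≠ 0) : GlueRel (Sum.inl (l, μ)) (Sum.inr (1 / l, μ / l ^ 2))

/-- The total space of the line bundle `𝒪(2)` on `ℙ¹`: two copies of `ℂ²` glued along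
`(l, μ) ↦ (1 / l, μ / l²)`, with the quotient topology. -/
abbrev SurfaceO2 : Type := Quot GlueRel

/-- The chart `(l, μ)` of the surface `𝒪(2)`. -/
def SurfaceO2.affine (x : ℂ × ℂ) : SurfaceO2 := Quot.mk GlueRel (Sum.inl x)

/-- The completion in `𝒪(2)` of a subset of the `(l, μ)`-plane. -/
def completion (S : Set (ℂ × ℂ)) : Set SurfaceO2 := closure (SurfaceO2.affine '' S)

/-- The spectral curve: the completion of the affine spectral curve in `𝒪(2)`. -/
def spectralCurve {n : ℕ} (α q p : Fin (n + 1) → ℝ) : Set SurfaceO2 :=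
  completion (affineSpectralCurve α q p)

/-- The completed parabola `μ = a l²`. -/
def parabola (a : ℝ) : Set SurfaceO2 := completion {x | x.2 = (a : ℂ) * x.1 ^ 2}

/-- The polynomial `l² D(z) + Q(z)` in `l = X 0` and `z = X 1`. Its zero set is the curve
`l² = - Q(z) / D(z)`, with the denominator cleared. -/
noncomputable def hyperPoly (D Q : ℂ[X]) : MvPolynomial (Fin 2) ℂ :=
  MvPolynomial.X 0 ^ 2 * aeval (MvPolynomial.X 1) D + aeval (MvPolynomial.X 1) Q

/-- The equation `D(z) + s² Q(z) = 0` of the same curve near `l = ∞`, in `s = 1 / l = X 0` and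
`z = X 1`. -/
noncomputable def hyperPolyAtInfinity (D Q : ℂ[X]) : MvPolynomial (Fin 2) ℂ :=
  aeval (MvPolynomial.X 1) D + MvPolynomial.X 0 ^ 2 * aeval (MvPolynomial.X 1) Q

/-- The points `(l, μ) = (l, l² z)` for `(l, z)` on the curve `l² D(z) + Q(z) = 0`,
completed in `𝒪(2)`. -/
def hyperCurve (D Q : ℂ[X]) : Set SurfaceO2 :=
  completion ((fun x : ℂ × ℂ => (x.1, x.1 ^ 2 * x.2)) ''
    {x | MvPolynomial.eval ![x.1, x.2] (hyperPoly D Q) = 0})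

/-- `x` is a singular point of the plane curve `g = 0`. -/
def IsSingularPoint (g : MvPolynomial (Fin 2) ℂ) (x : Fin 2 → ℂ) : Prop :=
  MvPolynomial.eval x g = 0 ∧ ∀ i, MvPolynomial.eval x (MvPolynomial.pderiv i g) = 0

/-- The Hilbert function of the closure in `ℙ¹ × ℙ¹` of the plane curve `f = 0`, for the Segre
embedding: the dimension of the space of polynomials that have degree at most `m` in each of the
two variables (the forms of bidegree `(m, m)`), modulo the multiples of `f`. -/
noncomputable def hilbertFunction (f : MvPolynomial (Fin 2) ℂ) (m : ℕ) : ℕ :=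
  Module.finrank ℂ ((MvPolynomial.restrictDegree (Fin 2) ℂ m).map
    (Ideal.Quotient.mkₐ ℂ (Ideal.span {f})).toLinearMap)

/-- The closure in `ℙ¹ × ℙ¹` of the plane curve `f = 0` (a projective scheme of dimension one)
has arithmetic genus `g = 1 - P(0)`, where `P` is its Hilbert polynomial. -/
def HasArithmeticGenus (f : MvPolynomial (Fin 2) ℂ) (g : ℕ) : Prop :=
  ∃ P : ℚ[X], P.natDegree = 1 ∧
    (∀ᶠ m : ℕ in Filter.atTop, (hilbertFunction f m : ℚ) = P.eval (m : ℚ)) ∧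
    (g : ℚ) = 1 - P.eval 0

end Neumann

namespace Neumann

open Polynomial

/-! ### Polynomials in two variables -/

/-! For `λ ≠ 0` and `z` not an eigenvalue, `λ²z - L(λ)` is the invertible diagonal matrix `λ²(z -
A)` plus a matrix of rank at most two. Its determinant therefore reduces to a 2×2 determinant in the
resolvent forms, and equals `λ^(2n) ∏ (z - α_j) (λ² + R(z))` with `R = Q_z(q,q) + Q_z(q,q) Q_z(p,p)
- Q_z(q,p)²` (`det_sub_laxMatrix_of_ne`). In `R` the contributions of a single index to the
quadratic part cancel, so a pole at `a` has order at most `min(m, 2)`: this is why `D` clears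
denominators. The factorization extends to all `λ`, `z` by density.

It determines the spectral curve off `λ = 0`. On `λ = 0`, `L(0) = -q ⊗ q` has the eigenvalues `0`
and `-1`. The point `(0, -1)` is invisible in the coordinates `(λ, z)`, being at `z = ∞`; continuity
of eigenvalues places it in the closure of the hyperelliptic component (`zero_neg_one_mem_closure`).

Since `‖q‖ = 1`, `Q` has degree `k + r - 1`, one less than `D`. A splitting of `λ²D + Q` with `D`,
`Q` coprime would make `-DQ` a square, against the odd degree of `DQ`. The genus comes from the
bidegree `(2, k + r)`, by counting monomials. -/

lemma eval_aeval_X (x : Fin 2 → ℂ) (i : Fin 2) (P : ℂ[X]) :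
    MvPolynomial.eval x (aeval (MvPolynomial.X i) P) = P.eval (x i) := by
  have h := Polynomial.map_aeval_eq_aeval_map (R := ℂ) (S := MvPolynomial (Fin 2) ℂ) (T := ℂ)
    (U := ℂ) (φ := RingHom.id ℂ) (ψ := MvPolynomial.eval x) (by ext; simp) P (MvPolynomial.X i)
  simpa [Polynomial.aeval_def] using h

lemma eval_hyperPoly (D Q : ℂ[X]) (l z : ℂ) :
    MvPolynomial.eval ![l, z] (hyperPoly D Q) = l ^ 2 * D.eval z + Q.eval z := by
  simp [hyperPoly, eval_aeval_X]

/-- The variable `s` enters only through `s²`, so at `s = 0` the value and both partial derivatives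
depend on `D` alone, and a double root of `D` suffices. -/
lemma isSingularPoint_hyperPolyAtInfinity {D : ℂ[X]} (Q : ℂ[X]) {a : ℂ} (h : D.eval a = 0)
    (h' : D.derivative.eval a = 0) : IsSingularPoint (hyperPolyAtInfinity D Q) ![0, a] := by
  have hd (P : ℂ[X]) (i : Fin 2) : MvPolynomial.pderiv i (aeval (MvPolynomial.X 1) P)
      = aeval (MvPolynomial.X 1) P.derivative
        * MvPolynomial.pderiv i (MvPolynomial.X 1 : MvPolynomial (Fin 2) ℂ) := by
    rw [Derivation.map_aeval, smul_eq_mul]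
  refine ⟨by simp [hyperPolyAtInfinity, eval_aeval_X, h], fun i => ?_⟩
  simp [hyperPolyAtInfinity, hd, eval_aeval_X, h']

lemma coeff_X_pow_mul_aeval (e : ℕ) (P : ℂ[X]) (m : Fin 2 →₀ ℕ) :
    MvPolynomial.coeff m (MvPolynomial.X 0 ^ e * aeval (MvPolynomial.X 1) P)
      = if m 0 = e then P.coeff (m 1) else 0 := by
  induction P using Polynomial.induction_on' with
  | add p q hp hq => rw [map_add, mul_add, MvPolynomial.coeff_add, hp, hq]; split_ifs <;> simp
  | monomial k c =>
    have h : MvPolynomial.X 0 ^ e * aeval (MvPolynomial.X 1) (monomial k c)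
        = MvPolynomial.monomial (Finsupp.single (0 : Fin 2) e + Finsupp.single 1 k) c := by
      rw [aeval_monomial, MvPolynomial.X_pow_eq_monomial, MvPolynomial.X_pow_eq_monomial,
        MvPolynomial.algebraMap_eq, MvPolynomial.C_apply, MvPolynomial.monomial_mul,
        MvPolynomial.monomial_mul]
      simp
    rw [h, MvPolynomial.coeff_monomial, Polynomial.coeff_monomial, ← ite_and]
    congr 1
    simp only [Finsupp.ext_iff, Fin.forall_fin_two, eq_iff_iff]
    simp [eq_comm]

lemma coeff_hyperPoly (D Q : ℂ[X]) (m : Fin 2 →₀ ℕ) :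
    MvPolynomial.coeff m (hyperPoly D Q)
      = (if m 0 = 2 then D.coeff (m 1) else 0) + if m 0 = 0 then Q.coeff (m 1) else 0 := by
  have h := coeff_X_pow_mul_aeval 0 Q m
  rw [pow_zero, one_mul] at h
  rw [hyperPoly, MvPolynomial.coeff_add, coeff_X_pow_mul_aeval, h]

/-- This single monomial attains both partial degrees of the polynomial when `deg Q ≤ deg D`. -/
lemma coeff_hyperPoly_top {D Q : ℂ[X]} (hD : D.Monic) :
    MvPolynomial.coeff (Finsupp.single 0 2 + Finsupp.single 1 D.natDegree) (hyperPoly D Q) = 1 := by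
  simp [coeff_hyperPoly, hD]

lemma degreeOf_zero_hyperPoly {D Q : ℂ[X]} (hD : D.Monic) :
    MvPolynomial.degreeOf 0 (hyperPoly D Q) = 2 := by
  apply le_antisymm
  · refine MvPolynomial.degreeOf_le_iff.2 fun m hm => ?_
    by_contra! h
    exact MvPolynomial.mem_support_iff.1 hm
      (by rw [coeff_hyperPoly, if_neg (by omega), if_neg (by omega), add_zero])
  · have := MvPolynomial.monomial_le_degreeOf (0 : Fin 2)
      (MvPolynomial.mem_support_iff.2 (by rw [coeff_hyperPoly_top (Q := Q) hD]; exact one_ne_zero))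
    simpa using this

lemma degreeOf_one_hyperPoly {D Q : ℂ[X]} (hD : D.Monic) (hQ : Q.natDegree ≤ D.natDegree) :
    MvPolynomial.degreeOf 1 (hyperPoly D Q) = D.natDegree := by
  apply le_antisymm
  · refine MvPolynomial.degreeOf_le_iff.2 fun m hm => ?_
    by_contra! h
    exact MvPolynomial.mem_support_iff.1 hm
      (by rw [coeff_hyperPoly, coeff_eq_zero_of_natDegree_lt h,
        coeff_eq_zero_of_natDegree_lt (hQ.trans_lt h), ite_self, ite_self, add_zero])
  · have := MvPolynomial.monomial_le_degreeOf (1 : Fin 2)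
      (MvPolynomial.mem_support_iff.2 (by rw [coeff_hyperPoly_top (Q := Q) hD]; exact one_ne_zero))
    simpa using this

/-! ### The arithmetic genus of a curve in `ℙ¹ × ℙ¹` -/

/-- The polynomials of degree at most `a` in the first and at most `b` in the second variable. -/
noncomputable abbrev bidegreeLE (a b : ℕ) : Submodule ℂ (MvPolynomial (Fin 2) ℂ) :=
  MvPolynomial.restrictSupport ℂ {s | s 0 ≤ a ∧ s 1 ≤ b}

lemma mem_bidegreeLE {a b : ℕ} {g : MvPolynomial (Fin 2) ℂ} :
    g ∈ bidegreeLE a b ↔ MvPolynomial.degreeOf 0 g ≤ a ∧ MvPolynomial.degreeOf 1 g ≤ b := by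
  rw [MvPolynomial.mem_restrictSupport_iff, MvPolynomial.degreeOf_le_iff,
    MvPolynomial.degreeOf_le_iff]
  exact ⟨fun h => ⟨fun m hm => (h hm).1, fun m hm => (h hm).2⟩,
    fun h m hm => ⟨h.1 m hm, h.2 m hm⟩⟩

lemma restrictDegree_eq_bidegreeLE (m : ℕ) :
    MvPolynomial.restrictDegree (Fin 2) ℂ m = bidegreeLE m m := by
  simp [MvPolynomial.restrictDegree, Fin.forall_fin_two]

/-- Exponents of bidegree at most `(a, b)`, as pairs of numbers. -/
noncomputable def bidegreeEquiv (a b : ℕ) :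
    {s : Fin 2 →₀ ℕ // s 0 ≤ a ∧ s 1 ≤ b} ≃ Fin (a + 1) × Fin (b + 1) where
  toFun s := (⟨s.1 0, Nat.lt_succ_of_le s.2.1⟩, ⟨s.1 1, Nat.lt_succ_of_le s.2.2⟩)
  invFun x := ⟨Finsupp.equivFunOnFinite.symm ![x.1, x.2],
    Nat.le_of_lt_succ x.1.2, Nat.le_of_lt_succ x.2.2⟩
  left_inv s := by ext i; fin_cases i <;> rfl
  right_inv x := rfl

lemma finrank_bidegreeLE (a b : ℕ) :
    Module.finrank ℂ (bidegreeLE a b) = (a + 1) * (b + 1) := by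
  rw [Module.finrank_eq_nat_card_basis (MvPolynomial.basisRestrictSupport ℂ _),
    Set.coe_ofPred, Nat.card_congr (bidegreeEquiv a b)]
  simp

/-- Partial degrees are additive in a domain, so a bidegree bound on a multiple of `f` is the
shifted bound on its cofactor. -/
lemma bidegreeLE_inf_span {f : MvPolynomial (Fin 2) ℂ} (hf : f ≠ 0) (a b : ℕ) :
    bidegreeLE (a + MvPolynomial.degreeOf 0 f) (b + MvPolynomial.degreeOf 1 f)
        ⊓ LinearMap.ker (Ideal.Quotient.mkₐ ℂ (Ideal.span {f})).toLinearMap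
      = (bidegreeLE a b).map (LinearMap.mulRight ℂ f) := by
  ext g
  have hk : g ∈ LinearMap.ker (Ideal.Quotient.mkₐ ℂ (Ideal.span {f})).toLinearMap ↔ f ∣ g := by
    rw [LinearMap.mem_ker, AlgHom.toLinearMap_apply, Ideal.Quotient.mkₐ_eq_mk,
      Ideal.Quotient.eq_zero_iff_mem, Ideal.mem_span_singleton]
  rw [Submodule.mem_inf, hk, Submodule.mem_map]
  constructor
  · rintro ⟨hg, h, rfl⟩
    refine ⟨h, ?_, mul_comm _ _⟩
    rcases eq_or_ne h 0 with rfl | hh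
    · exact Submodule.zero_mem _
    rw [mem_bidegreeLE, MvPolynomial.degreeOf_mul_eq hf hh,
      MvPolynomial.degreeOf_mul_eq hf hh] at hg
    exact mem_bidegreeLE.2 ⟨by omega, by omega⟩
  · rintro ⟨h, hh, rfl⟩
    rw [mem_bidegreeLE] at hh
    exact ⟨mem_bidegreeLE.2 ⟨(MvPolynomial.degreeOf_mul_le _ _ _).trans (by omega),
      (MvPolynomial.degreeOf_mul_le _ _ _).trans (by omega)⟩, Dvd.intro_left h rfl⟩

lemma finrank_map_add_finrank_inf_ker {K V W : Type*} [Field K] [AddCommGroup V] [Module K V]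
    [AddCommGroup W] [Module K W] (S : Submodule K V) [FiniteDimensional K S] (φ : V →ₗ[K] W) :
    Module.finrank K (S.map φ) + Module.finrank K ↥(S ⊓ LinearMap.ker φ)
      = Module.finrank K S := by
  have h := LinearMap.finrank_range_add_finrank_ker (φ.domRestrict S)
  rwa [LinearMap.range_domRestrict, LinearMap.ker_domRestrict,
    ← Submodule.finrank_map_subtype_eq, Submodule.map_comap_subtype] at h

lemma hilbertFunction_add {f : MvPolynomial (Fin 2) ℂ} (hf : f ≠ 0) (m a b : ℕ)
    (ha : m = a + MvPolynomial.degreeOf 0 f) (hb : m = b + MvPolynomial.degreeOf 1 f) :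
    hilbertFunction f m + (a + 1) * (b + 1) = (m + 1) * (m + 1) := by
  have h1 := bidegreeLE_inf_span hf a b
  rw [← ha, ← hb, ← restrictDegree_eq_bidegreeLE] at h1
  have h2 := finrank_map_add_finrank_inf_ker (MvPolynomial.restrictDegree (Fin 2) ℂ m)
    (Ideal.Quotient.mkₐ ℂ (Ideal.span {f})).toLinearMap
  rw [h1, LinearEquiv.finrank_eq (Submodule.equivMapOfInjective
      (LinearMap.mulRight ℂ f) (mul_left_injective₀ hf) _).symm, finrank_bidegreeLE] at h2
  rw [hilbertFunction, h2, restrictDegree_eq_bidegreeLE, finrank_bidegreeLE]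

/-- A curve of bidegree `(2, d)` in `ℙ¹ × ℙ¹` has arithmetic genus `d - 1`. -/
theorem hasArithmeticGenus_of_degreeOf {f : MvPolynomial (Fin 2) ℂ} {d : ℕ}
    (h0 : MvPolynomial.degreeOf 0 f = 2) (h1 : MvPolynomial.degreeOf 1 f = d + 1) :
    HasArithmeticGenus f d := by
  have hf : f ≠ 0 := by rintro rfl; simp at h0
  -- The Hilbert polynomial is `(m + 1)² - (m - 1)(m - d)`: all forms minus the multiples of `f`,
  -- whose cofactors have bidegree at most `(m - 2, m - d - 1)`.
  refine ⟨C ((d : ℚ) + 3) * X + C (1 - d : ℚ), natDegree_linear (by positivity), ?_, by simp⟩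
  filter_upwards [Filter.eventually_ge_atTop (d + 3)] with m hm
  obtain ⟨t, rfl⟩ := Nat.exists_eq_add_of_le hm
  have h := hilbertFunction_add hf (d + 3 + t) (d + 1 + t) (t + 2) (by omega) (by omega)
  have h' := congrArg (Nat.cast : ℕ → ℚ) h
  push_cast at h'
  simp only [eval_add, eval_mul, eval_C, eval_X]
  push_cast
  linear_combination h'

/-! ### Irreducibility -/

theorem irreducible_C_mul_X_sq_add_C {D Q : ℂ[X]} (hD : D ≠ 0) (hQ : Q ≠ 0) (hDQ : IsCoprime D Q)
    (hodd : Odd (D.natDegree + Q.natDegree)) :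
    Irreducible (C D * X ^ 2 + C Q : ℂ[X][X]) := by
  set F : ℂ[X][X] := C D * X ^ 2 + C Q with hF
  have hFdeg : F.natDegree = 2 := by rw [hF]; compute_degree!
  have c0 : F.coeff 0 = Q := by simp [hF]
  have c1 : F.coeff 1 = 0 := by simp [hF]
  have c2 : F.coeff 2 = D := by simp [hF]
  have hF0 : F ≠ 0 := by rintro h; rw [h] at hFdeg; simp at hFdeg
  -- A factor free of the outer variable divides both coefficients `D` and `Q`, which are coprime.
  have hconst (g h : ℂ[X][X]) (e : F = g * h) (hg : g.natDegree = 0) : IsUnit g := by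
    obtain ⟨u, rfl⟩ := natDegree_eq_zero.1 hg
    have hu : IsUnit u := hDQ.isUnit_of_dvd' (by rw [← c2, e, coeff_C_mul]; exact dvd_mul_right _ _)
      (by rw [← c0, e, coeff_C_mul]; exact dvd_mul_right _ _)
    exact hu.map C
  refine ⟨fun h => by have := natDegree_eq_zero_of_isUnit h; omega, fun g h e => ?_⟩
  have hg : g ≠ 0 := by rintro rfl; simp [e] at hF0
  have hh : h ≠ 0 := by rintro rfl; simp [e] at hF0
  have hdeg : g.natDegree + h.natDegree = 2 := by rw [← natDegree_mul hg hh, ← e, hFdeg]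
  by_cases hg0 : g.natDegree = 0
  · exact Or.inl (hconst g h e hg0)
  by_cases hh0 : h.natDegree = 0
  · exact Or.inr (hconst h g (e.trans (mul_comm _ _)) hh0)
  exfalso
  obtain ⟨a, b, rfl⟩ := exists_eq_X_add_C_of_natDegree_le_one (show g.natDegree ≤ 1 by omega)
  obtain ⟨c, d, rfl⟩ := exists_eq_X_add_C_of_natDegree_le_one (show h.natDegree ≤ 1 by omega)
  have e' : F = C (a * c) * X ^ 2 + C (a * d + b * c) * X ^ 1 + C (b * d) * X ^ 0 := by
    rw [e]; simp only [C_mul, C_add]; ring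
  have e0 : Q = b * d := by
    rw [← c0, e']; simp only [coeff_add, coeff_C_mul_X_pow]; simp
  have e1 : 0 = a * d + b * c := by
    rw [← c1, e']; simp only [coeff_add, coeff_C_mul_X_pow]; simp
  have e2 : D = a * c := by
    rw [← c2, e']; simp only [coeff_add, coeff_C_mul_X_pow]; simp
  -- The vanishing middle coefficient gives `bc = -ad`, hence `DQ = (ad)(bc) = -(ad)²`, of even
  -- degree.
  have key : D * Q = -((a * d) ^ 2) := by
    rw [e0, e2]; linear_combination (-(a * d)) * e1
  have := congrArg natDegree key
  rw [natDegree_mul hD hQ, natDegree_neg, natDegree_pow] at this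
  rw [this] at hodd
  exact (Nat.not_odd_iff_even.2 (even_two_mul _)) hodd

/-- Polynomials in `X 0` and `X 1` as polynomials in `X 0` over `ℂ[X 1]`. -/
noncomputable def finTwoAlgEquiv : MvPolynomial (Fin 2) ℂ ≃ₐ[ℂ] ℂ[X][X] :=
  (MvPolynomial.finSuccEquiv ℂ 1).trans
    (Polynomial.mapAlgEquiv (MvPolynomial.uniqueAlgEquiv ℂ (Fin 1)))

lemma finTwoAlgEquiv_X_zero : finTwoAlgEquiv (MvPolynomial.X 0) = X := by
  rw [finTwoAlgEquiv, AlgEquiv.trans_apply, MvPolynomial.finSuccEquiv_X_zero]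
  simp

lemma finTwoAlgEquiv_X_one : finTwoAlgEquiv (MvPolynomial.X 1) = C X := by
  have : MvPolynomial.finSuccEquiv ℂ 1 (MvPolynomial.X 1) = C (MvPolynomial.X 0) :=
    MvPolynomial.finSuccEquiv_X_succ (j := (0 : Fin 1))
  simp [finTwoAlgEquiv, this]

lemma finTwoAlgEquiv_hyperPoly (D Q : ℂ[X]) :
    finTwoAlgEquiv (hyperPoly D Q) = C D * X ^ 2 + C Q := by
  have h (P : ℂ[X]) : finTwoAlgEquiv (aeval (MvPolynomial.X 1) P) = C P := by
    rw [← Polynomial.aeval_algHom_apply, finTwoAlgEquiv_X_one]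
    have := Polynomial.aeval_algHom_apply (Algebra.ofId ℂ[X] ℂ[X][X] |>.restrictScalars ℂ) X P
    simpa [Algebra.ofId_apply] using this
  rw [hyperPoly, map_add, map_mul, map_pow, finTwoAlgEquiv_X_zero, h, h, mul_comm]

theorem irreducible_hyperPoly {D Q : ℂ[X]} (hD : D ≠ 0) (hQ : Q ≠ 0) (hDQ : IsCoprime D Q)
    (hodd : Odd (D.natDegree + Q.natDegree)) : Irreducible (hyperPoly D Q) := by
  rw [← MulEquiv.irreducible_iff finTwoAlgEquiv, finTwoAlgEquiv_hyperPoly]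
  exact irreducible_C_mul_X_sq_add_C hD hQ hDQ hodd

/-! ### The eigenvalues of `A` and the polynomial `D` -/

section Denominator

variable {n : ℕ} (α : Fin (n + 1) → ℝ)

lemma mem_eigs (j : Fin (n + 1)) : α j ∈ eigs α := Finset.mem_image_of_mem _ (Finset.mem_univ j)

lemma mult_pos {a : ℝ} (ha : a ∈ eigs α) : 0 < mult α a := by
  obtain ⟨j, -, rfl⟩ := Finset.mem_image.1 ha
  exact Finset.card_pos.2 ⟨j, by simp⟩

lemma filter_not_multiple : (eigs α).filter (fun a => ¬ 1 < mult α a) = simpleEigs α :=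
  Finset.filter_congr fun a ha => by have := mult_pos α ha; omega

lemma card_simpleEigs_add : (simpleEigs α).card + (multipleEigs α).card = (eigs α).card := by
  rw [add_comm, ← filter_not_multiple]
  exact Finset.card_filter_add_card_filter_not _

lemma prod_eigs {M : Type*} [CommMonoid M] (f : ℝ → M) :
    ∏ a ∈ eigs α, f a = (∏ a ∈ simpleEigs α, f a) * ∏ a ∈ multipleEigs α, f a := by
  rw [mul_comm, ← filter_not_multiple]
  exact (Finset.prod_filter_mul_prod_filter_not _ _ _).symm

lemma denom_eq_prod : denom α = ∏ a ∈ eigs α, (X - C (a : ℂ)) ^ min (mult α a) 2 := by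
  rw [prod_eigs, denom]
  congr 1
  · refine Finset.prod_congr rfl fun a ha => ?_
    rw [(Finset.mem_filter.1 ha).2, min_eq_left one_le_two, pow_one]
  · refine Finset.prod_congr rfl fun a ha => ?_
    rw [min_eq_right (Finset.mem_filter.1 ha).2]

lemma denom_monic : (denom α).Monic := by
  rw [denom_eq_prod]
  exact monic_prod_of_monic _ _ fun a _ => (monic_X_sub_C _).pow _

lemma natDegree_denom : (denom α).natDegree = (eigs α).card + (multipleEigs α).card := by
  rw [denom, Monic.natDegree_mul (monic_prod_of_monic _ _ fun a _ => monic_X_sub_C _)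
    (monic_prod_of_monic _ _ fun a _ => (monic_X_sub_C _).pow _),
    natDegree_prod_of_monic _ _ fun a _ => monic_X_sub_C _,
    natDegree_prod_of_monic _ _ fun a _ => (monic_X_sub_C _).pow _, ← card_simpleEigs_add]
  simp
  ring

lemma eval_denom_ne_zero {z : ℂ} (hz : ∀ a ∈ eigs α, z ≠ (a : ℂ)) : (denom α).eval z ≠ 0 := by
  rw [denom_eq_prod, eval_prod]
  exact Finset.prod_ne_zero_iff.2 fun a ha => by simp [sub_ne_zero.2 (hz a ha)]

lemma sq_dvd_denom {a : ℝ} (ha : a ∈ multipleEigs α) : (X - C (a : ℂ)) ^ 2 ∣ denom α :=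
  (Finset.dvd_prod_of_mem _ ha).mul_left _

lemma X_sub_C_dvd_denom {a : ℝ} (ha : a ∈ eigs α) : X - C (a : ℂ) ∣ denom α := by
  rw [denom_eq_prod]
  refine dvd_trans (dvd_pow_self _ ?_) (Finset.dvd_prod_of_mem _ ha)
  have := mult_pos α ha
  omega

/-- Two distinct indices sharing an eigenvalue make it multiple, and then `D` contains its square;
this is exactly what the cross terms of the numerator need. -/
lemma mul_X_sub_C_dvd_denom {i j : Fin (n + 1)} (hij : i ≠ j) :
    (X - C (α i : ℂ)) * (X - C (α j : ℂ)) ∣ denom α := by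
  by_cases h : α i = α j
  · rw [← h, ← sq]
    refine sq_dvd_denom α (Finset.mem_filter.2 ⟨mem_eigs α i, ?_⟩)
    exact Finset.one_lt_card.2 ⟨i, by simp, j, by simp [h], hij⟩
  · refine IsCoprime.mul_dvd ?_ (X_sub_C_dvd_denom α (mem_eigs α i))
      (X_sub_C_dvd_denom α (mem_eigs α j))
    exact isCoprime_X_sub_C_of_isUnit_sub (sub_ne_zero.2 (by exact_mod_cast h)).isUnit

lemma prod_sub_eq (z : ℂ) : ∏ j, (z - (α j : ℂ))
    = (∏ a ∈ multipleEigs α, (z - (a : ℂ)) ^ (mult α a - 2)) * (denom α).eval z := by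
  rw [Finset.prod_comp (fun a : ℝ => z - (a : ℂ)) α]
  change ∏ a ∈ eigs α, (z - (a : ℂ)) ^ mult α a = _
  rw [prod_eigs, denom, eval_mul, eval_prod, eval_prod, mul_left_comm, ← Finset.prod_mul_distrib]
  congr 1
  · refine Finset.prod_congr rfl fun a ha => ?_
    rw [(Finset.mem_filter.1 ha).2]; simp
  · refine Finset.prod_congr rfl fun a ha => ?_
    have := (Finset.mem_filter.1 ha).2
    simp only [eval_pow, eval_sub, eval_X, eval_C]
    rw [← pow_add, Nat.sub_add_cancel this]

lemma isCoprime_denom {Q : ℂ[X]} (hQ : ∀ a ∈ eigs α, Q.eval (a : ℂ) ≠ 0) :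
    IsCoprime (denom α) Q := by
  rw [denom_eq_prod]
  refine IsCoprime.prod_left fun a ha => IsCoprime.pow_left ?_
  refine ((irreducible_X_sub_C _).coprime_iff_not_dvd).2 fun h => hQ a ha (dvd_iff_isRoot.1 h)

end Denominator

/-! ### The polynomial `Q` -/

section Numerator

variable {n : ℕ} (α q p : Fin (n + 1) → ℝ)

/-- The numerator, over `denom α`, of the rational function
`Q_z(q,q) + Q_z(q,q) Q_z(p,p) - Q_z(q,p)²`. -/
noncomputable def numer : ℂ[X] :=
  ∑ j, C ((q j : ℂ) ^ 2) * (denom α /ₘ (X - C (α j : ℂ)))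
    + ∑ i, ∑ j, C ((q i : ℂ) ^ 2 * (p j : ℂ) ^ 2 - q i * p i * (q j * p j))
        * (denom α /ₘ ((X - C (α i : ℂ)) * (X - C (α j : ℂ))))

lemma eval_divByMonic {f g : ℂ[X]} (hg : g.Monic) (h : g ∣ f) {z : ℂ} (hz : g.eval z ≠ 0) :
    (f /ₘ g).eval z = f.eval z / g.eval z := by
  have := modByMonic_add_div f g
  rw [(modByMonic_eq_zero_iff_dvd hg).2 h, zero_add] at this
  rw [eq_div_iff hz, ← eval_mul, mul_comm, this]

theorem resolventForm_eq {z : ℂ} (hz : ∀ a ∈ eigs α, z ≠ (a : ℂ)) :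
    resolventForm α q q z + resolventForm α q q z * resolventForm α p p z
        - resolventForm α q p z ^ 2 = (numer α q p).eval z / (denom α).eval z := by
  have hz' (j) : z - (α j : ℂ) ≠ 0 := sub_ne_zero.2 (hz _ (mem_eigs α j))
  have hD := eval_denom_ne_zero α hz
  rw [eq_div_iff hD, numer, eval_add, eval_finsetSum, eval_finsetSum, add_sub_assoc, add_mul]
  congr 1
  · rw [resolventForm, Finset.sum_mul]
    refine Finset.sum_congr rfl fun j _ => ?_
    rw [eval_mul, eval_C, eval_divByMonic (monic_X_sub_C _)
      (X_sub_C_dvd_denom α (mem_eigs α j)) (by simpa using hz' j)]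
    simp only [eval_sub, eval_X, eval_C]
    ring
  · rw [sq (resolventForm α q p z), resolventForm, resolventForm, resolventForm,
      Finset.sum_mul_sum, Finset.sum_mul_sum, ← Finset.sum_sub_distrib, Finset.sum_mul]
    refine Finset.sum_congr rfl fun i _ => ?_
    rw [eval_finsetSum, ← Finset.sum_sub_distrib, Finset.sum_mul]
    refine Finset.sum_congr rfl fun j _ => ?_
    rw [eval_mul, eval_C]
    -- On the diagonal the coefficient is zero; there the division by `(X - α i)²` need not be
    -- exact.
    rcases eq_or_ne i j with rfl | hij
    · ring
    rw [eval_divByMonic ((monic_X_sub_C _).mul (monic_X_sub_C _)) (mul_X_sub_C_dvd_denom α hij)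
      (by simpa using ⟨hz' i, hz' j⟩)]
    simp only [eval_mul, eval_sub, eval_X, eval_C]
    have := hz' i
    have := hz' j
    field_simp

variable {α q p}

/-- The single sum has leading coefficient `∑ q_j² = 1`, and the double sum has lower degree. A
multiple eigenvalue forces `k + r ≥ 2`, so the truncated subtractions are genuine. -/
theorem natDegree_numer (hq : q ⬝ᵥ q = 1) (hdeg : (multipleEigs α).Nonempty) :
    (numer α q p).natDegree = (eigs α).card + (multipleEigs α).card - 1 := by
  have hr := hdeg.card_pos
  have hk : (multipleEigs α).card ≤ (eigs α).card := Finset.card_filter_le _ _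
  have hd := natDegree_denom α
  have h1 (j) : (denom α /ₘ (X - C (α j : ℂ))).natDegree
      = (eigs α).card + (multipleEigs α).card - 1 := by
    rw [natDegree_divByMonic _ (monic_X_sub_C _), hd, natDegree_X_sub_C]
  have h2 (i j) : (denom α /ₘ ((X - C (α i : ℂ)) * (X - C (α j : ℂ)))).natDegree
      = (eigs α).card + (multipleEigs α).card - 2 := by
    rw [natDegree_divByMonic _ ((monic_X_sub_C _).mul (monic_X_sub_C _)), hd,
      (monic_X_sub_C _).natDegree_mul (monic_X_sub_C _), natDegree_X_sub_C, natDegree_X_sub_C]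
  have hm (j) : (denom α /ₘ (X - C (α j : ℂ))).Monic := by
    have := modByMonic_add_div (denom α) (X - C (α j : ℂ))
    rw [(modByMonic_eq_zero_iff_dvd (monic_X_sub_C _)).2 (X_sub_C_dvd_denom α (mem_eigs α j)),
      zero_add] at this
    exact (monic_X_sub_C _).of_mul_monic_left (this ▸ denom_monic α)
  apply natDegree_eq_of_le_of_coeff_ne_zero
  · refine natDegree_add_le_of_degree_le (natDegree_sum_le_of_forall_le _ _ fun j _ => ?_)
      (natDegree_sum_le_of_forall_le _ _ fun i _ => natDegree_sum_le_of_forall_le _ _ fun j _ => ?_)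
    · exact (natDegree_C_mul_le _ _).trans (h1 j).le
    · exact (natDegree_C_mul_le _ _).trans ((h2 i j).trans_le (by omega))
  · have e1 (j) : (denom α /ₘ (X - C (α j : ℂ))).coeff
        ((eigs α).card + (multipleEigs α).card - 1) = 1 := by
      rw [← h1 j]; exact hm j
    have e2 (i j) : (denom α /ₘ ((X - C (α i : ℂ)) * (X - C (α j : ℂ)))).coeff
        ((eigs α).card + (multipleEigs α).card - 1) = 0 :=
      coeff_eq_zero_of_natDegree_lt (by rw [h2]; omega)
    have e3 : ∑ j, (q j : ℂ) ^ 2 = 1 := by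
      rw [dotProduct] at hq
      simp only [sq]
      exact_mod_cast hq
    simp only [numer, coeff_add, finsetSum_coeff, coeff_C_mul, e1, e2, mul_one, mul_zero, e3,
      Finset.sum_const_zero, add_zero]
    exact one_ne_zero

end Numerator

/-! ### The characteristic polynomial of the Lax matrix -/

section Determinant

variable {n : ℕ} (α q p : Fin (n + 1) → ℝ)

lemma laxMatrix_apply (l : ℂ) (i j : Fin (n + 1)) :
    laxMatrix α q p l i j = (if i = j then l ^ 2 * (α i : ℂ) else 0)
      + l * ((q i : ℂ) * p j - p i * q j) - q i * q j := by
  simp [laxMatrix, Matrix.diagonal_apply, Matrix.vecMulVec_apply]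

lemma det_sub_laxMatrix_of_ne {l z : ℂ} (hl : l ≠ 0) (hz : ∀ a ∈ eigs α, z ≠ (a : ℂ)) :
    ((l ^ 2 * z) • (1 : Matrix (Fin (n + 1)) (Fin (n + 1)) ℂ) - laxMatrix α q p l).det
      = l ^ (2 * n) * (∏ j, (z - (α j : ℂ))) * (l ^ 2 + (resolventForm α q q z
        + resolventForm α q q z * resolventForm α p p z - resolventForm α q p z ^ 2)) := by
  have hz' (j) : z - (α j : ℂ) ≠ 0 := sub_ne_zero.2 (hz _ (mem_eigs α j))
  -- The perturbation `q ⊗ q - λ(q ⊗ p - p ⊗ q)` equals `(q + λp) ⊗ q - λq ⊗ p`; the columns are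
  -- divided by the diagonal part.
  let A : Matrix (Fin (n + 1)) (Fin 2) ℂ := Matrix.of fun j =>
    ![((q j : ℂ) + l * p j) / (l ^ 2 * (z - α j)), -(l * q j) / (l ^ 2 * (z - α j))]
  let B : Matrix (Fin 2) (Fin (n + 1)) ℂ := ![fun j => (q j : ℂ), fun j => (p j : ℂ)]
  have hfac : (l ^ 2 * z) • (1 : Matrix (Fin (n + 1)) (Fin (n + 1)) ℂ) - laxMatrix α q p l
      = Matrix.diagonal (fun j => l ^ 2 * (z - (α j : ℂ))) * (1 + A * B) := by
    ext i j
    have := hz' i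
    rw [Matrix.diagonal_mul, Matrix.sub_apply, laxMatrix_apply, Matrix.add_apply,
      Matrix.mul_apply, Fin.sum_univ_two, Matrix.smul_apply, Matrix.one_apply]
    simp only [A, B, Matrix.of_apply, Matrix.cons_val_zero, Matrix.cons_val_one, smul_eq_mul]
    split_ifs <;> field_simp <;> ring
  have h00 : (B * A) 0 0 = (resolventForm α q q z + l * resolventForm α q p z) / l ^ 2 := by
    rw [Matrix.mul_apply, resolventForm, resolventForm, Finset.mul_sum,
      ← Finset.sum_add_distrib, Finset.sum_div]
    refine Finset.sum_congr rfl fun j _ => ?_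
    have := hz' j
    simp only [A, B, Matrix.of_apply, Matrix.cons_val_zero]
    field_simp
  have h01 : (B * A) 0 1 = -resolventForm α q q z / l := by
    rw [Matrix.mul_apply, resolventForm, ← Finset.sum_neg_distrib, Finset.sum_div]
    refine Finset.sum_congr rfl fun j _ => ?_
    have := hz' j
    simp only [A, B, Matrix.of_apply, Matrix.cons_val_zero, Matrix.cons_val_one]
    field_simp
  have h10 : (B * A) 1 0 = (resolventForm α q p z + l * resolventForm α p p z) / l ^ 2 := by
    rw [Matrix.mul_apply, resolventForm, resolventForm, Finset.mul_sum,
      ← Finset.sum_add_distrib, Finset.sum_div]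
    refine Finset.sum_congr rfl fun j _ => ?_
    have := hz' j
    simp only [A, B, Matrix.of_apply, Matrix.cons_val_zero, Matrix.cons_val_one]
    field_simp
  have h11 : (B * A) 1 1 = -resolventForm α q p z / l := by
    rw [Matrix.mul_apply, resolventForm, ← Finset.sum_neg_distrib, Finset.sum_div]
    refine Finset.sum_congr rfl fun j _ => ?_
    have := hz' j
    simp only [A, B, Matrix.of_apply, Matrix.cons_val_zero, Matrix.cons_val_one]
    field_simp
  -- Sylvester's identity `det(1 + AB) = det(1 + BA)` leaves a 2×2 determinant.
  rw [hfac, Matrix.det_mul, Matrix.det_diagonal, Matrix.det_one_add_mul_comm, Matrix.det_fin_two]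
  simp only [Matrix.add_apply, h00, h01, h10, h11, Matrix.one_apply_eq, Finset.prod_mul_distrib,
    Finset.prod_const, Finset.card_univ, Fintype.card_fin]
  rw [Matrix.one_apply_ne (by decide), Matrix.one_apply_ne (by decide), ← pow_mul, mul_add 2,
    pow_add]
  field_simp
  ring

lemma continuous_laxMatrix : Continuous (laxMatrix α q p) := by
  unfold laxMatrix
  fun_prop

theorem det_sub_laxMatrix (l z : ℂ) :
    ((l ^ 2 * z) • (1 : Matrix (Fin (n + 1)) (Fin (n + 1)) ℂ) - laxMatrix α q p l).det
      = l ^ (2 * n) * (∏ a ∈ multipleEigs α, (z - (a : ℂ)) ^ (mult α a - 2))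
        * (l ^ 2 * (denom α).eval z + (numer α q p).eval z) := by
  have hfin : (((↑) : ℝ → ℂ) '' (eigs α : Set ℝ)).Finite := (eigs α).finite_toSet.image _
  -- Both sides are continuous in `(λ, z)`, so the excluded values of `λ` and `z` can be restored by
  -- density.
  have hdense : Dense (({0}ᶜ : Set ℂ) ×ˢ (((↑) : ℝ → ℂ) '' (eigs α : Set ℝ))ᶜ) :=
    (dense_compl_singleton 0).prod (hfin.countable.dense_compl ℝ)
  have hL := continuous_laxMatrix α q p
  have key := Continuous.ext_on hdense
    (f := fun x : ℂ × ℂ => ((x.1 ^ 2 * x.2) • (1 : Matrix (Fin (n + 1)) (Fin (n + 1)) ℂ)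
      - laxMatrix α q p x.1).det)
    (g := fun x : ℂ × ℂ => x.1 ^ (2 * n)
      * (∏ a ∈ multipleEigs α, (x.2 - (a : ℂ)) ^ (mult α a - 2))
      * (x.1 ^ 2 * (denom α).eval x.2 + (numer α q p).eval x.2))
    (by apply Continuous.matrix_det; fun_prop)
    (by fun_prop) ?_
  · exact congrFun key (l, z)
  rintro ⟨l, z⟩ ⟨hl, hz⟩
  have hz' : ∀ a ∈ eigs α, z ≠ (a : ℂ) := fun a ha h => hz ⟨a, ha, h.symm⟩
  have hD := eval_denom_ne_zero α hz'
  dsimp only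
  rw [det_sub_laxMatrix_of_ne α q p hl hz', resolventForm_eq α q p hz', prod_sub_eq]
  field_simp

end Determinant

/-! ### The components of the spectral curve -/

section SpectralCurve

variable {n : ℕ} {α q p : Fin (n + 1) → ℝ}

lemma det_smul_one_sub_laxMatrix_zero (hq : q ⬝ᵥ q = 1) {μ : ℂ} (hμ : μ ≠ 0) :
    (μ • (1 : Matrix (Fin (n + 1)) (Fin (n + 1)) ℂ) - laxMatrix α q p 0).det
      = μ ^ n * (μ + 1) := by
  have hq' : ∑ j, (q j : ℂ) * q j = 1 := by exact_mod_cast hq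
  have h : μ • (1 : Matrix (Fin (n + 1)) (Fin (n + 1)) ℂ) - laxMatrix α q p 0
      = μ • (1 + Matrix.replicateCol Unit (fun j => μ⁻¹ * (q j : ℂ))
        * Matrix.replicateRow Unit fun j => (q j : ℂ)) := by
    ext i j
    simp only [Matrix.sub_apply, Matrix.smul_apply, laxMatrix_apply, Matrix.add_apply,
      Matrix.mul_apply, Matrix.replicateCol_apply, Matrix.replicateRow_apply, smul_eq_mul]
    simp
    field_simp
  rw [h, Matrix.det_smul, Matrix.det_one_add_replicateCol_mul_replicateRow, dotProduct,
    Finset.sum_congr rfl fun j _ => mul_left_comm _ _ _, ← Finset.mul_sum, hq', Fintype.card_fin,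
    pow_succ]
  field_simp

lemma mem_affineSpectralCurve {x : ℂ × ℂ} : x ∈ affineSpectralCurve α q p ↔
    (x.2 • (1 : Matrix (Fin (n + 1)) (Fin (n + 1)) ℂ) - laxMatrix α q p x.1).det = 0 := by
  rw [affineSpectralCurve, Set.mem_ofPred_eq, ← neg_sub, Matrix.det_neg]
  simp

/-- Away from `l = 0`, the affine spectral curve consists of parabolas and the
hyperelliptic curve. -/
lemma mem_affineSpectralCurve_of_ne {l : ℂ} (hl : l ≠ 0) (μ : ℂ) :
    (l, μ) ∈ affineSpectralCurve α q p ↔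
      (∃ a ∈ (multipleEigs α).filter (fun a => 3 ≤ mult α a), μ = (a : ℂ) * l ^ 2) ∨
      ∃ z, μ = l ^ 2 * z ∧ l ^ 2 * (denom α).eval z + (numer α q p).eval z = 0 := by
  obtain ⟨z, rfl⟩ : ∃ z, μ = l ^ 2 * z := ⟨μ / l ^ 2, by field_simp⟩
  have hl2 : l ^ 2 ≠ 0 := pow_ne_zero 2 hl
  rw [mem_affineSpectralCurve, det_sub_laxMatrix, mul_eq_zero, mul_eq_zero,
    or_iff_right (pow_ne_zero _ hl), Finset.prod_eq_zero_iff]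
  refine or_congr ⟨?_, ?_⟩ ⟨fun h => ⟨z, rfl, h⟩, ?_⟩
  · rintro ⟨a, ha, h⟩
    have h0 : mult α a - 2 ≠ 0 := fun h0 => by simp [h0] at h
    refine ⟨a, Finset.mem_filter.2 ⟨ha, by omega⟩, ?_⟩
    rw [sub_eq_zero.1 (eq_zero_of_pow_eq_zero h), mul_comm]
  · rintro ⟨a, ha, h⟩
    obtain ⟨ha, h3⟩ := Finset.mem_filter.1 ha
    rw [mul_comm] at h
    exact ⟨a, ha, by rw [mul_right_cancel₀ hl2 h, sub_self, zero_pow (by omega)]⟩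
  · rintro ⟨w, hw, h⟩
    rwa [mul_left_cancel₀ hl2 hw]

/-- Eigenvalues of `L(l)` tend to the eigenvalue `-1` of `L(0) = -q ⊗ q` as `l → 0`. -/
lemma zero_neg_one_mem_closure (hq : q ⬝ᵥ q = 1) :
    ((0 : ℂ), (-1 : ℂ)) ∈ closure {x | x ∈ affineSpectralCurve α q p ∧ x.1 ≠ 0} := by
  rw [Metric.mem_closure_iff]
  intro ε hε
  have hcont : Continuous fun l : ℂ => ‖((-1 : ℂ) • (1 : Matrix (Fin (n + 1)) (Fin (n + 1)) ℂ)
      - laxMatrix α q p l).det‖ := by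
    have hL := continuous_laxMatrix α q p
    refine Continuous.norm (Continuous.matrix_det ?_)
    fun_prop
  have h0 := det_smul_one_sub_laxMatrix_zero (α := α) (p := p) hq (neg_ne_zero.2 one_ne_zero)
  have hev : ∀ᶠ l in nhds (0 : ℂ), ‖((-1 : ℂ) • (1 : Matrix (Fin (n + 1)) (Fin (n + 1)) ℂ)
      - laxMatrix α q p l).det‖ < ε ^ (n + 1) := by
    refine hcont.continuousAt.eventually_lt_const ?_
    dsimp only
    rw [h0]
    simpa using pow_pos hε (n + 1)
  obtain ⟨δ, hδ, hball⟩ := Metric.eventually_nhds_iff.1 hev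
  obtain ⟨l, hl0, hl⟩ := NormedField.exists_norm_lt ℂ (lt_min hδ hε)
  have hlne : l ≠ 0 := norm_pos_iff.1 hl0
  have hlt := hball (y := l) (by simpa using hl.trans_le (min_le_left _ _))
  set f := (laxMatrix α q p l).charpoly with hf
  have hfm : f.Monic := Matrix.charpoly_monic _
  have hfe (μ : ℂ) : f.eval μ
      = (μ • (1 : Matrix (Fin (n + 1)) (Fin (n + 1)) ℂ) - laxMatrix α q p l).det := by
    rw [hf, Matrix.eval_charpoly, Matrix.smul_one_eq_diagonal]; rfl
  obtain ⟨μ, hμ, hμε⟩ : ∃ μ ∈ f.roots, ‖-1 - μ‖ < ε := by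
    -- If all `n + 1` roots were at distance at least `ε` from `-1`, the monic `f` would satisfy
    -- `|f(-1)| ≥ ε^(n+1)`.
    by_contra! hcon
    have hs := IsAlgClosed.splits f
    have hprod := hs.eval_eq_prod_roots_of_monic hfm (-1)
    have hcard : f.roots.card = n + 1 := by
      rw [← hs.natDegree_eq_card_roots, hf, Matrix.charpoly_natDegree_eq_dim, Fintype.card_fin]
    rw [← hfe, hprod] at hlt
    have hge : (f.roots.map fun _ => ε).prod ≤ (f.roots.map fun μ => ‖-1 - μ‖).prod :=
      Multiset.prod_map_le_prod_map₀ _ _ (fun _ _ => hε.le) hcon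
    rw [Multiset.map_const', Multiset.prod_replicate, hcard] at hge
    refine absurd hlt (not_lt.2 (hge.trans_eq ?_))
    have := map_multiset_prod (normHom : ℂ →*₀ ℝ) (f.roots.map fun μ => -1 - μ)
    rw [Multiset.map_map] at this
    exact this.symm
  refine ⟨(l, μ), ⟨mem_affineSpectralCurve.2 ?_, hlne⟩, ?_⟩
  · rw [← hfe]; exact (mem_roots'.1 hμ).2
  · rw [Prod.dist_eq, max_lt_iff, dist_eq_norm, dist_eq_norm, zero_sub, norm_neg]
    exact ⟨hl.trans_le (min_le_right _ _), hμε⟩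

lemma continuous_affine : Continuous SurfaceO2.affine :=
  continuous_quot_mk.comp continuous_inl

lemma subset_completion (S : Set (ℂ × ℂ)) : SurfaceO2.affine '' S ⊆ completion S := subset_closure

lemma completion_mono {S T : Set (ℂ × ℂ)} (h : S ⊆ T) : completion S ⊆ completion T :=
  closure_mono (Set.image_mono h)

lemma affine_mem_completion {S : Set (ℂ × ℂ)} {x : ℂ × ℂ} (h : x ∈ closure S) :
    SurfaceO2.affine x ∈ completion S :=
  image_closure_subset_closure_image continuous_affine ⟨x, h, rfl⟩

theorem spectralCurve_eq (hq : q ⬝ᵥ q = 1) (hdeg : (multipleEigs α).Nonempty) :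
    spectralCurve α q p = {SurfaceO2.affine (0, 0)}
      ∪ (⋃ a ∈ (multipleEigs α).filter (fun a => 3 ≤ mult α a), parabola a)
      ∪ hyperCurve (denom α) (numer α q p) := by
  set I := (multipleEigs α).filter (fun a => 3 ≤ mult α a)
  set H : Set (ℂ × ℂ) := (fun x : ℂ × ℂ => (x.1, x.1 ^ 2 * x.2)) ''
    {x | MvPolynomial.eval ![x.1, x.2] (hyperPoly (denom α) (numer α q p)) = 0}
  have hn : n ≠ 0 := by
    rintro rfl
    obtain ⟨a, ha⟩ := hdeg
    have h1 := (Finset.mem_filter.1 ha).2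
    have h2 : mult α a ≤ 1 := (Finset.card_filter_le _ _).trans (by simp)
    omega
  have hcard := hdeg.card_pos
  have hle : (multipleEigs α).card ≤ (eigs α).card := Finset.card_filter_le _ _
  -- Every root `z` of the nonconstant `Q` gives a point `(0, z)`, which `μ = λ²z` contracts to the
  -- origin.
  have h0H : ((0 : ℂ), (0 : ℂ)) ∈ H := by
    obtain ⟨z, hz⟩ := IsAlgClosed.exists_root (numer α q p) (ne_of_gt (natDegree_pos_iff_degree_pos.1
      (by rw [natDegree_numer hq hdeg]; omega)))
    exact ⟨(0, z), by simpa [eval_hyperPoly] using hz, by simp⟩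
  have h0S : ((0 : ℂ), (0 : ℂ)) ∈ affineSpectralCurve α q p := by
    have := det_sub_laxMatrix α q p 0 0
    rw [zero_pow (by omega : 2 * n ≠ 0)] at this
    rw [mem_affineSpectralCurve]
    simpa using this
  have hne {l μ : ℂ} (hl : l ≠ 0) : (l, μ) ∈ affineSpectralCurve α q p ↔
      (∃ a ∈ I, μ = (a : ℂ) * l ^ 2) ∨ (l, μ) ∈ H := by
    rw [mem_affineSpectralCurve_of_ne hl]
    refine or_congr Iff.rfl ⟨?_, ?_⟩
    · rintro ⟨z, rfl, hz⟩
      exact ⟨(l, z), by simpa [eval_hyperPoly] using hz, rfl⟩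
    · rintro ⟨⟨l', z⟩, hz, he⟩
      obtain ⟨rfl, rfl⟩ := Prod.mk.inj he
      exact ⟨z, rfl, by simpa [eval_hyperPoly] using hz⟩
  have hHS : H ⊆ affineSpectralCurve α q p := by
    intro x hx
    by_cases hl : x.1 = 0
    · obtain ⟨y, hy, rfl⟩ := hx
      dsimp only at hl ⊢
      rw [hl]
      simpa using h0S
    · exact (hne hl).2 (Or.inr hx)
  have hPS {a : ℝ} (ha : a ∈ I) : {x : ℂ × ℂ | x.2 = (a : ℂ) * x.1 ^ 2}
      ⊆ affineSpectralCurve α q p := by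
    rintro ⟨l, μ⟩ hx
    by_cases hl : l = 0
    · subst hl
      have : μ = 0 := by simpa using hx
      rwa [this]
    · exact (hne hl).2 (Or.inl ⟨a, ha, hx⟩)
  -- The nearby points of the curve with `λ ≠ 0` lie on the parabolas or on `H`; the finite union of
  -- parabolas is closed and misses `(0, -1)`.
  have h1H : ((0 : ℂ), (-1 : ℂ)) ∈ closure H := by
    have hsub : {x | x ∈ affineSpectralCurve α q p ∧ x.1 ≠ 0}
        ⊆ (⋃ a ∈ I, {x : ℂ × ℂ | x.2 = (a : ℂ) * x.1 ^ 2}) ∪ H := by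
      rintro ⟨l, μ⟩ ⟨hx, hl⟩
      rcases (hne hl).1 hx with ⟨a, ha, h⟩ | h
      · exact Or.inl (Set.mem_biUnion ha h)
      · exact Or.inr h
    have hclosed : IsClosed (⋃ a ∈ I, {x : ℂ × ℂ | x.2 = (a : ℂ) * x.1 ^ 2}) :=
      I.finite_toSet.isClosed_biUnion fun a _ => isClosed_eq (by fun_prop) (by fun_prop)
    have := closure_mono hsub (zero_neg_one_mem_closure hq)
    rw [closure_union, hclosed.closure_eq] at this
    refine this.resolve_left fun h => ?_
    simp at h
  have hSsub : affineSpectralCurve α q p ⊆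
      (⋃ a ∈ I, {x : ℂ × ℂ | x.2 = (a : ℂ) * x.1 ^ 2}) ∪ closure H := by
    rintro ⟨l, μ⟩ hx
    by_cases hl : l = 0
    · subst hl
      by_cases hμ : μ = 0
      · exact Or.inr (subset_closure (hμ ▸ h0H))
      · rw [mem_affineSpectralCurve, det_smul_one_sub_laxMatrix_zero hq hμ, mul_eq_zero,
          or_iff_right (pow_ne_zero _ hμ), add_eq_zero_iff_eq_neg] at hx
        exact Or.inr (hx ▸ h1H)
    · rcases (hne hl).1 hx with ⟨a, ha, h⟩ | h
      · exact Or.inl (Set.mem_biUnion ha h)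
      · exact Or.inr (subset_closure h)
  have hunion : ({SurfaceO2.affine (0, 0)} ∪ ⋃ a ∈ I, parabola a)
      ∪ hyperCurve (denom α) (numer α q p) = (⋃ a ∈ I, parabola a) ∪ completion H := by
    rw [Set.union_assoc]
    refine Set.union_eq_self_of_subset_left (Set.singleton_subset_iff.2 (Or.inr ?_))
    exact subset_completion H ⟨_, h0H, rfl⟩
  rw [hunion]
  apply Set.Subset.antisymm
  · refine closure_minimal ?_ ((I.finite_toSet.isClosed_biUnion fun a _ => isClosed_closure).union
      isClosed_closure)
    rintro _ ⟨x, hx, rfl⟩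
    rcases hSsub hx with h | h
    · obtain ⟨a, ha, h⟩ := Set.mem_iUnion₂.1 h
      exact Or.inl (Set.mem_biUnion ha (subset_completion _ ⟨x, h, rfl⟩))
    · exact Or.inr (affine_mem_completion h)
  · exact Set.union_subset (Set.iUnion₂_subset fun a ha => completion_mono (hPS ha))
      (completion_mono hHS)

end SpectralCurve

end Neumann

theorem mainTheorem3 {n : ℕ} (α q p : Fin (n + 1) → ℝ)
    (hq : q ⬝ᵥ q = 1) (hqp : q ⬝ᵥ p = 0)
    (hdeg : (Neumann.multipleEigs α).Nonempty) :
    ∃ Q : Polynomial ℂ,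
      -- `Q` is the numerator of the rational function of `z` defined by `q` and `p`
      Q.natDegree = (Neumann.eigs α).card + (Neumann.multipleEigs α).card - 1 ∧
      (∀ z : ℂ, (∀ a ∈ Neumann.eigs α, z ≠ (a : ℂ)) →
        Neumann.resolventForm α q q z
            + Neumann.resolventForm α q q z * Neumann.resolventForm α p p z
            - Neumann.resolventForm α q p z ^ 2
          = Q.eval z / (Neumann.denom α).eval z) ∧
      -- the components with their multiplicities, in the coordinates `l` and `z = μ / l²`
      (∀ l z : ℂ,
        ((l ^ 2 * z) • (1 : Matrix (Fin (n + 1)) (Fin (n + 1)) ℂ)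
            - Neumann.laxMatrix α q p l).det
          = l ^ (2 * n) * (∏ a ∈ Neumann.multipleEigs α, (z - (a : ℂ)) ^ (Neumann.mult α a - 2))
            * MvPolynomial.eval ![l, z] (Neumann.hyperPoly (Neumann.denom α) Q)) ∧
      -- the spectral curve is the union of the components
      Neumann.spectralCurve α q p
        = {Neumann.SurfaceO2.affine (0, 0)}
          ∪ (⋃ a ∈ (Neumann.multipleEigs α).filter (fun a => 3 ≤ Neumann.mult α a),
              Neumann.parabola a)
          ∪ Neumann.hyperCurve (Neumann.denom α) Q ∧
      -- the hyperelliptic component is singular over `l = ∞`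
      (∀ a ∈ Neumann.multipleEigs α,
        Neumann.IsSingularPoint (Neumann.hyperPolyAtInfinity (Neumann.denom α) Q)
          ![0, (a : ℂ)]) ∧
      -- it is irreducible unless numerator and denominator have a common zero
      ((∀ a ∈ Neumann.eigs α, Q.eval (a : ℂ) ≠ 0) →
        Irreducible (Neumann.hyperPoly (Neumann.denom α) Q)) ∧
      Neumann.HasArithmeticGenus (Neumann.hyperPoly (Neumann.denom α) Q)
        ((Neumann.eigs α).card + (Neumann.multipleEigs α).card - 1) := by
  have hr := hdeg.card_pos
  have hle : (Neumann.multipleEigs α).card ≤ (Neumann.eigs α).card := Finset.card_filter_le _ _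
  have hQdeg := Neumann.natDegree_numer (p := p) hq hdeg
  have hDdeg := Neumann.natDegree_denom α
  have hD := Neumann.denom_monic α
  refine ⟨Neumann.numer α q p, hQdeg, fun z hz => Neumann.resolventForm_eq α q p hz,
    fun l z => ?_, Neumann.spectralCurve_eq hq hdeg, fun a ha => ?_, fun h => ?_, ?_⟩
  · rw [Neumann.eval_hyperPoly, Neumann.det_sub_laxMatrix]
  · obtain ⟨g, hg⟩ := Neumann.sq_dvd_denom α ha
    exact Neumann.isSingularPoint_hyperPolyAtInfinity _ (by simp [hg])
      (by simp [hg, Polynomial.derivative_mul, Polynomial.derivative_pow])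
  · refine Neumann.irreducible_hyperPoly hD.ne_zero ?_ (Neumann.isCoprime_denom α h) ?_
    · intro h0
      rw [h0, Polynomial.natDegree_zero] at hQdeg
      omega
    · rw [hDdeg, hQdeg]
      -- The degrees add up to `(k + r) + (k + r - 1) = 2(k + r - 1) + 1`.
      exact ⟨(Neumann.eigs α).card + (Neumann.multipleEigs α).card - 1, by omega⟩
  · refine Neumann.hasArithmeticGenus_of_degreeOf (Neumann.degreeOf_zero_hyperPoly hD) ?_
    rw [Neumann.degreeOf_one_hyperPoly hD (by omega), hDdeg]
    omega
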